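/- Let $d\ge 1$, let $p,q\in[1,\infty)$ with $q\ne p$, and write $\|x\|_r=(\sum_{i=1}^d|x_i|^r)^{1/r}$ for $x\in\mathbb R^d$ and $r\ge 1$. Let $\mu,\nu$ be Borel probability measures on $\mathbb R^d$ with finite moments of order $p$, i.e. $\int\|x\|_p^p\,\mu(dx)<\infty$ and $\int\|x\|_p^p\,\nu(dx)<\infty$. Let $F_i$ and $G_i$ ($i=1,\dots,d$) be the distribution functions of the one-dimensional margins of $\mu$ and $\nu$, and suppose that $\mu$ and $\nu$ share the same copula: there is a $d$-dimensional copula $C:[0,1]^d\to[0,1]$ (a grounded, $d$-increasing function with uniform margins) such that for all $x\in\mathbb R^d$ $$\mu\Big(\prod_{i=1}^d(-\infty,x_i]\Big)=C(F_1(x_1),\dots,F_d(x_d)),\qquad \nu\Big(\prod_{i=1}^d(-\infty,x_i]\Big)=C(G_1(x_1),\dots,G_d(x_d)).$$ Define $W_{p,q}(\mu,\nu)\in[0,\infty]$ by $$(W_{p,q}(\mu,\nu))^p=\inf_{\pi}\int_{\mathbb R^d\times\mathbb R^d}\|x-y\|_q^p\,\pi(dx,dy),$$ where the infimum is over all couplings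 $\pi$ of $\mu$ and $\nu$ (probability measures on $\mathbb R^d\times\mathbb R^d$ with marginals $\mu$ and $\nu$). Let $F^{-1}(u)=(F_1^{-1}(u),\dots,F_d^{-1}(u))$ and $G^{-1}(u)=(G_1^{-1}(u),\dots,G_d^{-1}(u))$, where $F_i^{-1}(u)=\inf\{x\in\mathbb R: F_i(x)\ge u\}$ is the generalized inverse, and similarly for $G_i^{-1}$. Then $\int_{[0,1]}\|F^{-1}(u)-G^{-1}(u)\|_p^p\,du$ and $W_{p,q}(\mu,\nu)$ are finite, and: 1. if $1\le q\le p<\infty$, then $$\int_{[0,1]}\|F^{-1}(u)-G^{-1}(u)\|_p^p\,du\le (W_{p,q}(\mu,\nu))^p\le d^{\frac pq-1}\int_{[0,1]}\|F^{-1}(u)-G^{-1}(u)\|_p^p\,du;$$ 2. if $1\le p\le q<\infty$, then $$d^{\frac pq-1}\int_{[0,1]}\|F^{-1}(u)-G^{-1}(u)\|_p^p\,du\le (W_{p,q}(\mu,\nu))^p\le \int_{[0,1]}\|F^{-1}(u)-G^{-1}(u)\|_p^p\,du.$$ -/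

import Mathlib

open MeasureTheory Set
open scoped ENNReal unitInterval

namespace CopulaWasserstein

noncomputable section

/-- The `q`-norm `‖x‖_q` on `ℝ^d`, for real `q ≥ 1` (Mathlib's `ℓ^q` norm on `PiLp`). -/
def vecNorm {d : ℕ} (q : ℝ) (x : Fin d → ℝ) : ℝ :=
  ‖(WithLp.toLp (ENNReal.ofReal q) x : PiLp (ENNReal.ofReal q) (fun _ : Fin d => ℝ))‖

/-- The explicit formula `‖x‖_q = (∑ i, |x i| ^ q) ^ (1 / q)`. -/
theorem vecNorm_eq_sum {d : ℕ} {q : ℝ} (hq : 1 ≤ q) (x : Fin d → ℝ) :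
    vecNorm q x = (∑ i, |x i| ^ q) ^ (1 / q) := by
  have h0 : 0 < q := by linarith
  unfold vecNorm
  rw [PiLp.norm_eq_sum (by rwa [ENNReal.toReal_ofReal h0.le])]
  simp [ENNReal.toReal_ofReal h0.le, Real.norm_eq_abs]

/-- `μ` has a finite moment of order `p`; for a probability measure `μ` this says `μ ∈ P_p(ℝ^d)`.
The base point is the origin; the condition does not depend on it. -/
def HasFiniteMoment {d : ℕ} (p : ℝ) (μ : Measure (Fin d → ℝ)) : Prop :=
  ∫⁻ x, ENNReal.ofReal (vecNorm p x ^ p) ∂μ < ∞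

/-- `π` is a coupling of `μ` and `ν`: its marginals are `μ` and `ν`. If `μ` is a probability
measure, then so is `π`. -/
def IsCoupling {d : ℕ} (π : Measure ((Fin d → ℝ) × (Fin d → ℝ))) (μ ν : Measure (Fin d → ℝ)) :
    Prop :=
  π.map Prod.fst = μ ∧ π.map Prod.snd = ν

/-- The Wasserstein distance `W_{p,q}` of order `p` with respect to the `q`-norm:
`W_{p,q}(μ, ν)^p = inf_π ∫ ‖x - y‖_q^p π(dx, dy)`, over all couplings `π` of `μ` and `ν`.
It takes values in `[0, ∞]`. -/
def wasserstein {d : ℕ} (p q : ℝ) (μ ν : Measure (Fin d → ℝ)) : ℝ≥0∞ :=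
  (⨅ (π : Measure ((Fin d → ℝ) × (Fin d → ℝ))) (_ : IsCoupling π μ ν),
    ∫⁻ z, ENNReal.ofReal (vecNorm q (z.1 - z.2) ^ p) ∂π) ^ (1 / p)

/-- A `d`-dimensional copula `C : [0,1]^d → [0,1]`. -/
structure IsCopula {d : ℕ} (C : (Fin d → I) → I) : Prop where
  /-- groundedness -/
  grounded : ∀ u : Fin d → I, (∃ i, u i = 0) → C u = 0
  /-- `d`-increasing: the signed sum of `C` over the vertices of each box `[a, b]` is nonnegative.
  A vertex is given by the set `S` of the coordinates in which it agrees with `a`, and its sign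
  is `(-1)^|S|`. -/
  increasing : ∀ a b : Fin d → I, a ≤ b →
    0 ≤ ∑ S : Finset (Fin d), (-1 : ℝ) ^ S.card * (C (fun j => if j ∈ S then a j else b j) : ℝ)
  /-- uniform margins -/
  uniform_margins : ∀ (i : Fin d) (t : I), C (Function.update (fun _ => 1) i t) = t

/-- The distribution function of the `i`-th one-dimensional margin of `μ`. -/
def marginCdf {d : ℕ} (μ : Measure (Fin d → ℝ)) (i : Fin d) (x : ℝ) : ℝ :=
  ProbabilityTheory.cdf (μ.map (fun y => y i)) x

theorem marginCdf_mem {d : ℕ} (μ : Measure (Fin d → ℝ)) (i : Fin d) (x : ℝ) :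
    marginCdf μ i x ∈ I :=
  ⟨ProbabilityTheory.cdf_nonneg _ x, ProbabilityTheory.cdf_le_one _ x⟩

/-- The joint distribution function `H_μ(x) = μ((-∞, x_1] × ⋯ × (-∞, x_d])`. -/
def jointCdf {d : ℕ} (μ : Measure (Fin d → ℝ)) (x : Fin d → ℝ) : ℝ :=
  μ.real {y | ∀ i, y i ≤ x i}

/-- `H_μ(x_1, …, x_d) = C(F_1(x_1), …, F_d(x_d))` for all `x`, where `F_i` are the marginal
distribution functions of `μ`. -/
def HasCopula {d : ℕ} (μ : Measure (Fin d → ℝ)) (C : (Fin d → I) → I) : Prop :=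
  ∀ x : Fin d → ℝ, jointCdf μ x = C (fun i => ⟨marginCdf μ i (x i), marginCdf_mem μ i (x i)⟩)

/-- `μ` and `ν` share the same copula. -/
def ShareCopula {d : ℕ} (μ ν : Measure (Fin d → ℝ)) : Prop :=
  ∃ C : (Fin d → I) → I, IsCopula C ∧ HasCopula μ C ∧ HasCopula ν C

/-- The generalized inverse (quantile function) `F⁻¹(u) = inf {x | F x ≥ u}`. For a distribution
function `F` and `0 < u < 1` the set is nonempty and bounded below; at `u = 0` and `u = 1` the
infimum can be infinite, and `sInf` then takes the value `0`, which no integral over `[0,1]`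
sees. -/
def genInverse (F : ℝ → ℝ) (u : ℝ) : ℝ :=
  sInf {x : ℝ | u ≤ F x}

/-- The vector `F⁻¹(u) = (F_1⁻¹(u), …, F_d⁻¹(u))` of the marginal quantile functions of `μ`. -/
def quantile {d : ℕ} (μ : Measure (Fin d → ℝ)) (u : ℝ) : Fin d → ℝ :=
  fun i => genInverse (marginCdf μ i) u

/-- `∫_{[0,1]} ‖F⁻¹(u) - G⁻¹(u)‖_p^p du`, with values in `[0, ∞]`. -/
def quantileCost {d : ℕ} (p : ℝ) (μ ν : Measure (Fin d → ℝ)) : ℝ≥0∞ :=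
  ∫⁻ u in Icc (0 : ℝ) 1, ENNReal.ofReal (vecNorm p (quantile μ u - quantile ν u) ^ p)

end

end CopulaWasserstein

open MeasureTheory Set
open scoped ENNReal unitInterval

namespace CopulaWasserstein

/-! For `q = p` the cost splits as `∑ i, |x i - y i| ^ p`. The `i`-th term sees only a coupling of
the `i`-th margins, hence is at least the one-dimensional optimum, which the quantile functions
attain (`lintegral_openQuantile_sub_le`). Indeed `|x - y| ^ p` is a mixture of the indicators of `y
+ t ≤ s < x` and `x + t ≤ s < y` with `t ≥ 0`, and the quantile functions minimise the probability
of each of these events.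

The one-dimensional optima need not fit together into a coupling of `μ` and `ν`; a common copula `C`
makes them fit. If `U` has distribution function `C`, the vectors of `F_i⁻¹(U_i)` and of
`G_i⁻¹(U_i)` have laws `μ` and `ν` (`HasCopula.map_openQuantile`), and every coordinate pair is
optimal, so the lower bound is attained (`ShareCopula.exists_isCoupling`). Such a `U` exists by
compactness, as a limit of discrete laws on finite grids (`IsCopula.exists_measure`).

For `q ≠ p`, pointwise comparison of `‖x‖_q ^ p` with `‖x‖_p ^ p`, with constants `1` and `d ^ (p /
q - 1)`, passes through the integral and the infimum. -/

/-! ### Copulas as probability measures on the unit cube -/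

open Finset in
/-- Telescoping of the signed vertex sums over the unit cells of a grid. -/
theorem sum_cell_volume {d : ℕ} (c : (Fin d → ℕ) → ℝ) (hc : ∀ m, (∃ i, m i = 0) → c m = 0)
    (M : Fin d → ℕ) :
    ∑ m ∈ Fintype.piFinset (fun j => range (M j)),
      ∑ S : Finset (Fin d), (-1 : ℝ) ^ #S * c (fun j => if j ∈ S then m j else m j + 1) = c M := by
  set T := Fintype.piFinset (fun j => range (M j + 1))
  -- By linearity it suffices to treat point indicators. These are products over the coordinates, so
  -- their signed vertex sum factors into one-dimensional differences, which telescope.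
  have key : ∀ x ∈ T, c x = ∑ y ∈ T, c y * ∏ j, (if x j = y j then (1 : ℝ) else 0) := by
    intro x hx
    have h1 : ∀ y, (∏ j, (if x j = y j then (1 : ℝ) else 0)) = if x = y then 1 else 0 := by
      intro y
      rw [Finset.prod_ite_zero]
      simp [funext_iff]
    simp [h1, hx]
  have key2 : ∀ m y : Fin d → ℕ, ∑ S : Finset (Fin d), (-1 : ℝ) ^ #S *
      (∏ j, (if (if j ∈ S then m j else m j + 1) = y j then (1 : ℝ) else 0)) =
      ∏ j, ((if m j + 1 = y j then (1 : ℝ) else 0) - (if m j = y j then (1 : ℝ) else 0)) := by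
    intro m y
    rw [Finset.prod_sub, Finset.powerset_univ]
    refine Finset.sum_congr rfl fun S _ => ?_
    rw [mul_assoc, ← Finset.prod_sdiff (Finset.subset_univ S)]
    congr 2
    · refine Finset.prod_congr rfl fun j hj => ?_
      simp [(Finset.mem_sdiff.1 hj).2]
    · refine Finset.prod_congr rfl fun j hj => ?_
      simp [hj]
  have hMT : M ∈ T := by simp [T]
  calc _ = ∑ m ∈ Fintype.piFinset (fun j => range (M j)), ∑ S : Finset (Fin d), ∑ y ∈ T,
        c y * ((-1 : ℝ) ^ #S *
          (∏ j, (if (if j ∈ S then m j else m j + 1) = y j then (1 : ℝ) else 0))) := by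
        refine Finset.sum_congr rfl fun m hm => Finset.sum_congr rfl fun S _ => ?_
        rw [key _ _, Finset.mul_sum]
        · refine Finset.sum_congr rfl fun y _ => by ring
        · simp only [Fintype.mem_piFinset, Finset.mem_range, T] at hm ⊢
          intro j
          have := hm j
          split_ifs <;> omega
    _ = ∑ y ∈ T, c y * ∑ m ∈ Fintype.piFinset (fun j => range (M j)), ∏ j,
        ((if m j + 1 = y j then (1 : ℝ) else 0) - (if m j = y j then (1 : ℝ) else 0)) := by
        simp_rw [← key2, Finset.mul_sum]
        conv_rhs => rw [Finset.sum_comm]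
        refine Finset.sum_congr rfl fun m _ => Finset.sum_comm
    _ = ∑ y ∈ T, c y * ∏ j, (if M j = y j then (1 : ℝ) else 0) := by
        refine Finset.sum_congr rfl fun y _ => ?_
        -- Groundedness disposes of the points where the lower boundary term of the telescoping sum
        -- would survive.
        by_cases hy : ∃ i, y i = 0
        · simp [hc y hy]
        push Not at hy
        rw [← Finset.prod_univ_sum (fun j => range (M j)) (fun j k =>
          (if k + 1 = y j then (1 : ℝ) else 0) - (if k = y j then (1 : ℝ) else 0))]
        congr 1
        refine Finset.prod_congr rfl fun j _ => ?_
        rw [Finset.sum_range_sub (fun k => if k = y j then (1 : ℝ) else 0)]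
        simp [(hy j).symm]
    _ = c M := (key M hMT).symm

/-- Every finite subset of `[0, 1]` lies on a strictly increasing grid from `0` to `1`. -/
theorem exists_grid (A : Finset I) : ∃ (n : ℕ) (a : ℕ → I), StrictMonoOn a (Iic n) ∧ a 0 = 0 ∧
    a n = 1 ∧ ∀ x ∈ A, ∃ k ≤ n, a k = x := by
  classical
  set B : Finset I := insert 0 (insert 1 A) with hB
  have hcard : 0 < B.card := Finset.card_pos.2 ⟨0, by simp [hB]⟩
  obtain ⟨n, hn⟩ : ∃ n, B.card = n + 1 := ⟨B.card - 1, by omega⟩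
  set e := B.orderEmbOfFin hn
  have hsurj : ∀ x ∈ B, ∃ k : Fin (n + 1), e k = x := by
    intro x hx
    have : x ∈ Set.range e := by rw [Finset.range_orderEmbOfFin]; exact hx
    exact this
  refine ⟨n, fun k => e ⟨min k n, by omega⟩, ?_, ?_, ?_, ?_⟩
  · intro k hk l hl hkl
    simp only [Set.mem_Iic] at hk hl
    refine e.strictMono ?_
    simp [Fin.lt_def]; omega
  · obtain ⟨k, hk⟩ := hsurj 0 (by simp [hB])
    refine le_antisymm ?_ unitInterval.nonneg'
    rw [← hk]
    exact e.monotone (by simp)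
  · obtain ⟨k, hk⟩ := hsurj 1 (by simp [hB])
    refine le_antisymm unitInterval.le_one' ?_
    rw [← hk]
    exact e.monotone (Fin.le_def.2 (by show k.1 ≤ min n n; omega))
  · intro x hx
    obtain ⟨k, hk⟩ := hsurj x (by simp [hB, hx])
    refine ⟨k, by omega, ?_⟩
    rw [← hk]
    exact congrArg e (Fin.ext (by show min k.1 n = k.1; omega))

theorem IsCopula.one_eq_one {d : ℕ} (hd : 1 ≤ d) {C : (Fin d → I) → I} (hC : IsCopula C) :
    C (fun _ => 1) = 1 := by
  have := hC.uniform_margins ⟨0, hd⟩ 1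
  rwa [Function.update_eq_self_iff.2 rfl] at this

/-- A copula is the distribution function of a probability measure on any finite grid. -/
theorem IsCopula.exists_measure_grid {d : ℕ} (hd : 1 ≤ d) {C : (Fin d → I) → I} (hC : IsCopula C)
    (A : Finset I) : ∃ P : ProbabilityMeasure (Fin d → I), ∀ x : Fin d → I, (∀ i, x i ∈ A) →
      (P : Measure (Fin d → I)) (Iic x) = ENNReal.ofReal (C x) := by
  classical
  obtain ⟨n, a, ha, ha0, ha1, hA⟩ := exists_grid (insert 1 A)
  set T : Finset (Fin d → ℕ) := Fintype.piFinset (fun _ => Finset.range n)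
  set V : (Fin d → ℕ) → ℝ := fun m => ∑ S : Finset (Fin d), (-1 : ℝ) ^ S.card *
    (C (fun j => a (if j ∈ S then m j else m j + 1)) : ℝ) with hV
  have hVnonneg : ∀ m ∈ T, 0 ≤ V m := by
    intro m hm
    have h := hC.increasing (fun j => a (m j)) (fun j => a (m j + 1)) (fun j => by
      have : m j < n := by simpa using Fintype.mem_piFinset.1 hm j
      exact (ha (by simp; omega) (by simp; omega) (by omega)).le)
    refine h.trans_eq (Finset.sum_congr rfl fun S _ => ?_)
    congr 3
    ext j
    split_ifs <;> rfl
  -- The mass of each cell sits at its upper vertex, so a box below the grid point of index `M`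
  -- collects exactly the cells `m` with `m j < M j` for all `j`.
  set P : Measure (Fin d → I) :=
    ∑ m ∈ T, ENNReal.ofReal (V m) • Measure.dirac (fun j => a (m j + 1)) with hP
  have hcdf : ∀ x : Fin d → I, (∀ i, x i ∈ insert 1 A) → P (Iic x) = ENNReal.ofReal (C x) := by
    intro x hx
    choose M hM hMx using fun i => hA (x i) (hx i)
    have h1 : P (Iic x) = ∑ m ∈ T, if m ∈ Fintype.piFinset (fun j => Finset.range (M j)) then
        ENNReal.ofReal (V m) else 0 := by
      rw [hP, Measure.finsetSum_apply]
      refine Finset.sum_congr rfl fun m hm => ?_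
      have hiff : (fun j => a (m j + 1)) ∈ Iic x ↔
          m ∈ Fintype.piFinset (fun j => Finset.range (M j)) := by
        simp only [Set.mem_Iic, Pi.le_def, Fintype.mem_piFinset, Finset.mem_range]
        refine forall_congr' fun j => ?_
        have : m j < n := by simpa using Fintype.mem_piFinset.1 hm j
        rw [← hMx j, ha.le_iff_le (by simp; omega) (by simpa using hM j)]
        omega
      rw [Measure.smul_apply, Measure.dirac_apply' _ measurableSet_Iic, Set.indicator_apply]
      simp only [hiff, Pi.one_apply, smul_eq_mul]
      split_ifs <;> simp
    have hsub : Fintype.piFinset (fun j => Finset.range (M j)) ⊆ T :=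
      Fintype.piFinset_subset _ _ fun j => Finset.range_subset_range.2 (hM j)
    rw [h1, ← Finset.sum_filter, Finset.filter_mem_eq_inter, Finset.inter_eq_right.2 hsub,
      ← ENNReal.ofReal_sum_of_nonneg fun m hm => hVnonneg m (hsub hm),
      sum_cell_volume (fun m => (C (fun j => a (m j)) : ℝ))]
    · simp [hMx]
    · rintro m ⟨i, hi⟩
      simp [hC.grounded (fun j => a (m j)) ⟨i, by simp [hi, ha0]⟩]
  refine ⟨⟨P, ⟨?_⟩⟩, fun x hx => hcdf x fun i => by simp [hx i]⟩
  have := hcdf (fun _ => 1) (by simp)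
  rw [hC.one_eq_one hd] at this
  rw [← Set.eq_univ_of_forall (s := Iic (fun _ : Fin d => (1 : I))) fun x i =>
    unitInterval.le_one', this]
  simp

theorem Iic_update_one {d : ℕ} (i : Fin d) (t : I) :
    Iic (Function.update (fun _ => (1 : I)) i t) = {x : Fin d → I | x i ≤ t} := by
  ext x
  simp only [mem_Iic, mem_ofPred_eq, Pi.le_def]
  refine ⟨fun h => by simpa using h i, fun h j => ?_⟩
  rcases eq_or_ne j i with rfl | hj
  · simpa using h
  · simpa [hj] using unitInterval.le_one'

/-- A copula is Lipschitz. -/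
theorem IsCopula.le_add_sum_sub {d : ℕ} (hd : 1 ≤ d) {C : (Fin d → I) → I} (hC : IsCopula C)
    {u v : Fin d → I} (huv : u ≤ v) : (C v : ℝ) ≤ C u + ∑ i, ((v i : ℝ) - u i) := by
  classical
  obtain ⟨P, hP⟩ := hC.exists_measure_grid hd
    (insert 1 (Finset.univ.image u ∪ Finset.univ.image v))
  have hmargin : ∀ i, ∀ t ∈ (insert 1 (Finset.univ.image u ∪ Finset.univ.image v) : Finset I),
      (P : Measure (Fin d → I)) {x | x i ≤ t} = ENNReal.ofReal t := by
    intro i t ht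
    rw [← Iic_update_one, hP, hC.uniform_margins]
    intro j
    rcases eq_or_ne j i with rfl | hj
    · simpa using ht
    · simp [hj]
  -- Each slab has mass `v i - u i` by uniformity of the margins; the union bound gives the
  -- Lipschitz estimate.
  have hsub : Iic v ⊆ Iic u ∪ ⋃ i, ({x : Fin d → I | x i ≤ v i} \ {x | x i ≤ u i}) := by
    intro x hx
    by_cases h : x ≤ u
    · exact Or.inl h
    · rw [Pi.le_def, not_forall] at h
      obtain ⟨i, hi⟩ := h
      exact Or.inr (mem_iUnion.2 ⟨i, hx i, hi⟩)
  have h := calc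
    (P : Measure (Fin d → I)) (Iic v) ≤ (P : Measure (Fin d → I)) (Iic u) +
        ∑ i, (P : Measure (Fin d → I)) ({x : Fin d → I | x i ≤ v i} \ {x | x i ≤ u i}) :=
      (measure_mono hsub).trans ((measure_union_le _ _).trans
        (add_le_add_right (measure_iUnion_fintype_le _ _) _))
    _ = ENNReal.ofReal (C u) + ∑ i, ENNReal.ofReal ((v i : ℝ) - u i) := by
      rw [hP u (fun i => by simp)]
      congr 1
      refine Finset.sum_congr rfl fun i _ => ?_
      have hle : {x : Fin d → I | x i ≤ u i} ⊆ {x | x i ≤ v i} := fun x hx => le_trans hx (huv i)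
      rw [measure_sdiff hle, hmargin i _ (by simp),
        hmargin i _ (by simp), ENNReal.ofReal_sub _ (u i).2.1]
      · exact (measurableSet_le (measurable_pi_apply i) measurable_const).nullMeasurableSet
      · exact measure_ne_top _ _
  have h0 : ∀ i ∈ Finset.univ, 0 ≤ (v i : ℝ) - u i := fun i _ => sub_nonneg.2 (huv i)
  rw [hP v (fun i => by simp), ← ENNReal.ofReal_sum_of_nonneg h0,
    ← ENNReal.ofReal_add (C u).2.1 (Finset.sum_nonneg h0)] at h
  exact (ENNReal.ofReal_le_ofReal_iff (add_nonneg (C u).2.1 (Finset.sum_nonneg h0))).1 h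

/-- Every copula is the distribution function of a probability measure on `[0, 1]^d`. -/
theorem IsCopula.exists_measure {d : ℕ} (hd : 1 ≤ d) {C : (Fin d → I) → I} (hC : IsCopula C) :
    ∃ P : ProbabilityMeasure (Fin d → I), ∀ x : Fin d → I,
      (P : Measure (Fin d → I)) (Iic x) = ENNReal.ofReal (C x) := by
  classical
  choose Q hQ using fun A => hC.exists_measure_grid hd A
  -- Along an ultrafilter finer than `atTop` the grid measures converge by compactness, and each
  -- fixed `x` eventually lies on the grid.
  set l : Ultrafilter (Finset I) := Ultrafilter.of Filter.atTop
  obtain ⟨P, -, hP⟩ := isCompact_univ.ultrafilter_le_nhds (l.map Q) (by simp)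
  have hlim : Filter.Tendsto Q l (nhds P) := hP
  have hev : ∀ x : Fin d → I, ∀ᶠ A in (l : Filter (Finset I)),
      (Q A : Measure (Fin d → I)) (Iic x) = ENNReal.ofReal (C x) := by
    intro x
    refine Ultrafilter.of_le _ ?_
    filter_upwards [Filter.eventually_ge_atTop (Finset.univ.image x)] with A hA
    exact hQ A x fun i => hA (by simp)
  refine ⟨P, fun x => le_antisymm ?_ ?_⟩
  -- The portmanteau bound in this direction needs an open set: the box is enlarged by `η = ε / d`
  -- in each coordinate, which raises `C` by at most `ε`.
  · refine ENNReal.le_of_forall_pos_le_add fun ε hε _ => ?_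
    have hd0 : (0 : ℝ) < d := by exact_mod_cast hd
    set η : ℝ := ε / d with hη
    have hη0 : 0 < η := div_pos hε hd0
    set v : Fin d → I := fun i => ⟨min 1 (x i + η), le_min zero_le_one
      (add_nonneg (x i).2.1 hη0.le), min_le_left _ _⟩ with hv
    have hxv : x ≤ v := fun i => Subtype.coe_le_coe.1 (le_min (x i).2.2 (by linarith))
    have hG : IsOpen {y : Fin d → I | ∀ i, (y i : ℝ) < x i + η} := by
      simp only [ofPred_forall]
      exact isOpen_iInter_of_finite fun i => isOpen_lt (by fun_prop) continuous_const
    calc (P : Measure (Fin d → I)) (Iic x)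
        ≤ (P : Measure (Fin d → I)) {y : Fin d → I | ∀ i, (y i : ℝ) < x i + η} :=
          measure_mono fun y hy i => lt_of_le_of_lt (Subtype.coe_le_coe.2 (hy i)) (by linarith)
      _ ≤ _ := ProbabilityMeasure.le_liminf_measure_open_of_tendsto hlim hG
      _ ≤ Filter.liminf (fun A => (Q A : Measure (Fin d → I)) (Iic v)) l := by
          refine Filter.liminf_le_liminf (Filter.Eventually.of_forall fun A => measure_mono ?_)
          exact fun y hy i => Subtype.coe_le_coe.1 (le_min (y i).2.2 (hy i).le)
      _ = ENNReal.ofReal (C v) := by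
          rw [Filter.liminf_congr (hev v), Filter.liminf_const]
      _ ≤ ENNReal.ofReal (C x + ε) := by
          refine ENNReal.ofReal_le_ofReal ((hC.le_add_sum_sub hd hxv).trans ?_)
          have : ∑ i, ((v i : ℝ) - x i) ≤ ∑ i : Fin d, η :=
            Finset.sum_le_sum fun i _ => by
              have : (v i : ℝ) ≤ x i + η := min_le_right _ _
              linarith
          have h2 : ∑ i : Fin d, η = ε := by
            simp [hη]; field_simp
          linarith
      _ ≤ _ := ENNReal.ofReal_add_le.trans (by simp)
  · have := ProbabilityMeasure.limsup_measure_closed_le_of_tendsto hlim (isClosed_Iic (a := x))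
    rwa [Filter.limsup_congr (hev x), Filter.limsup_const] at this

/-- The one-dimensional margins of a probability measure whose distribution function is a copula
are uniform on `[0, 1]`. -/
theorem IsCopula.measurePreserving_coe_eval {d : ℕ} {C : (Fin d → I) → I} (hC : IsCopula C)
    {P : Measure (Fin d → I)} [IsProbabilityMeasure P]
    (hP : ∀ x, P (Iic x) = ENNReal.ofReal (C x)) (i : Fin d) :
    MeasurePreserving (fun u : Fin d → I => (u i : ℝ)) P (volume.restrict (Icc 0 1)) := by
  have h1 : MeasurePreserving (fun u : Fin d → I => u i) P volume := by
    refine ⟨measurable_pi_apply i, Measure.ext_of_Iic _ _ fun t => ?_⟩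
    rw [Measure.map_apply (measurable_pi_apply i) measurableSet_Iic, unitInterval.volume_Iic]
    have := hP (Function.update (fun _ => 1) i t)
    rwa [hC.uniform_margins, Iic_update_one] at this
  have h2 : MeasurePreserving ((↑) : I → ℝ) volume (volume.restrict (Icc 0 1)) :=
    measurePreserving_subtype_coe measurableSet_Icc
  exact h2.comp h1

/-! ### Comparing the moments of a difference -/

/-- For `p ≥ 1`, the function `z ↦ z ^ p` on `[0, ∞)` is a mixture of the functions
`z ↦ max (z - t) 0`, `t ≥ 0`. -/
theorem exists_mixture_rpow {p : ℝ} (hp : 1 ≤ p) : ∃ m : Measure ℝ, SFinite m ∧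
    (∀ᵐ t ∂m, 0 ≤ t) ∧
    ∀ z : ℝ, 0 ≤ z → ∫⁻ t, ENNReal.ofReal (z - t) ∂m = ENNReal.ofReal (z ^ p) := by
  -- For `p > 1` this is Taylor's formula `z ^ p = ∫_0^z p (p - 1) t ^ (p - 2) (z - t) dt`. At `p =
  -- 1` that density vanishes and a point mass at `0` replaces it.
  rcases hp.eq_or_lt with rfl | hp
  · refine ⟨Measure.dirac 0, inferInstance, ?_, fun z _ => ?_⟩
    · rw [ae_dirac_eq]; exact le_refl (0 : ℝ)
    · rw [lintegral_dirac]; simp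
  have hmeas : Measurable fun t : ℝ => ENNReal.ofReal (p * (p - 1) * t ^ (p - 2)) := by fun_prop
  refine ⟨(volume.restrict (Ioi 0)).withDensity
    (fun t => ENNReal.ofReal (p * (p - 1) * t ^ (p - 2))), inferInstance, ?_, fun z hz => ?_⟩
  · refine (withDensity_absolutelyContinuous _ _).ae_le ?_
    filter_upwards [ae_restrict_mem measurableSet_Ioi] with t ht using (mem_Ioi.1 ht).le
  rw [lintegral_withDensity_eq_lintegral_mul _ hmeas (by fun_prop)]
  set f : ℝ → ℝ := fun t => p * (p - 1) * (z * t ^ (p - 2) - t ^ (p - 1)) with hf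
  have h1 : ∀ t ∈ Ioi (0 : ℝ), ((fun t : ℝ => ENNReal.ofReal (p * (p - 1) * t ^ (p - 2))) *
      fun t => ENNReal.ofReal (z - t)) t = (Ioc 0 z).indicator (fun t => ENNReal.ofReal (f t)) t := by
    intro t ht
    have ht : 0 < t := ht
    rw [Pi.mul_apply, ← ENNReal.ofReal_mul (by
      have := Real.rpow_nonneg ht.le (p - 2)
      have : 0 ≤ p * (p - 1) := by nlinarith
      positivity)]
    have heq : p * (p - 1) * t ^ (p - 2) * (z - t) = f t := by
      have : t ^ (p - 1) = t ^ (p - 2) * t := by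
        rw [← Real.rpow_add_one ht.ne']; ring_nf
      rw [hf]; simp only [this]; ring
    by_cases htz : t ≤ z
    · rw [indicator_of_mem (show t ∈ Ioc 0 z from ⟨ht, htz⟩), heq]
    · rw [indicator_of_notMem (fun h => htz h.2)]
      refine ENNReal.ofReal_eq_zero.2 (mul_nonpos_of_nonneg_of_nonpos ?_ (by linarith))
      have := Real.rpow_nonneg ht.le (p - 2)
      have : 0 ≤ p * (p - 1) := by nlinarith
      positivity
  rw [setLIntegral_congr_fun measurableSet_Ioi h1, lintegral_indicator measurableSet_Ioc,
    Measure.restrict_restrict measurableSet_Ioc, inter_eq_left.2 (fun t ht => ht.1)]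
  have hi1 : IntervalIntegrable (fun t : ℝ => t ^ (p - 2)) volume 0 z :=
    intervalIntegral.intervalIntegrable_rpow' (by linarith)
  have hi2 : IntervalIntegrable (fun t : ℝ => t ^ (p - 1)) volume 0 z :=
    intervalIntegral.intervalIntegrable_rpow' (by linarith)
  have hint : IntervalIntegrable f volume 0 z := ((hi1.const_mul z).sub hi2).const_mul _
  rw [← ofReal_integral_eq_lintegral_ofReal
    ((intervalIntegrable_iff_integrableOn_Ioc_of_le hz).1 hint),
    ← intervalIntegral.integral_of_le hz]
  · congr 1
    rw [hf, intervalIntegral.integral_const_mul, intervalIntegral.integral_sub (hi1.const_mul z) hi2,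
      intervalIntegral.integral_const_mul, integral_rpow (Or.inl (by linarith)),
      integral_rpow (Or.inl (by linarith))]
    rw [Real.zero_rpow (by linarith), Real.zero_rpow (by linarith)]
    have h3 : z * z ^ (p - 2 + 1) = z ^ p := by
      rcases hz.eq_or_lt with rfl | hz
      · rw [Real.zero_rpow (by linarith : p ≠ 0), zero_mul]
      · rw [mul_comm, ← Real.rpow_add_one hz.ne']; ring_nf
    rw [show p - 1 + 1 = p by ring, sub_zero, sub_zero, mul_div_assoc', h3]
    have hp1 : p - 1 ≠ 0 := by linarith
    have hp0 : p ≠ 0 := by linarith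
    rw [show p - 2 + 1 = p - 1 by ring]
    have h7 : p - (p - 1) = 1 := by ring
    field_simp
    rw [h7, mul_one]
  · filter_upwards [ae_restrict_mem measurableSet_Ioc] with t ht
    have ht0 : 0 < t := ht.1
    have : t ^ (p - 1) = t ^ (p - 2) * t := by
      rw [← Real.rpow_add_one ht0.ne']; ring_nf
    have h4 : f t = p * (p - 1) * (t ^ (p - 2) * (z - t)) := by
      rw [hf]; simp only [this]; ring
    rw [h4]
    have h5 := Real.rpow_nonneg ht0.le (p - 2)
    have h6 : 0 ≤ z - t := by linarith [ht.2]
    have : 0 ≤ p * (p - 1) := by nlinarith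
    exact mul_nonneg this (mul_nonneg h5 h6)

theorem measurableSet_le_and_lt {Ω : Type*} [MeasurableSpace Ω] {f g h : Ω → ℝ}
    (hf : Measurable f) (hg : Measurable g) (hh : Measurable h) :
    MeasurableSet {ω | f ω ≤ g ω ∧ g ω < h ω} := by
  have := (measurableSet_le hf hg).inter (measurableSet_lt hg hh)
  exact this

/-- The positive part of `X - Y - t` is the length of the interval `[Y + t, X)`; then Tonelli. -/
theorem lintegral_ofReal_sub_sub {Ω : Type*} [MeasurableSpace Ω] (ρ : Measure Ω) [SFinite ρ]
    {X Y : Ω → ℝ} (hX : Measurable X) (hY : Measurable Y) (t : ℝ) :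
    ∫⁻ ω, ENNReal.ofReal (X ω - Y ω - t) ∂ρ = ∫⁻ s, ρ {ω | Y ω + t ≤ s ∧ s < X ω} := by
  set S : Set (Ω × ℝ) := {z | Y z.1 + t ≤ z.2 ∧ z.2 < X z.1}
  have hS : MeasurableSet S :=
    measurableSet_le_and_lt (by fun_prop) measurable_snd (hX.comp measurable_fst)
  calc ∫⁻ ω, ENNReal.ofReal (X ω - Y ω - t) ∂ρ
      = ∫⁻ ω, ∫⁻ s : ℝ, S.indicator (fun _ => 1) (ω, s) ∂volume ∂ρ := by
        refine lintegral_congr fun ω => ?_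
        rw [sub_sub, ← Real.volume_Ico, ← lintegral_indicator_one measurableSet_Ico]
        rfl
    _ = ∫⁻ s : ℝ, ∫⁻ ω, S.indicator (fun _ => 1) (ω, s) ∂ρ :=
        lintegral_lintegral_swap (f := fun ω s => S.indicator (fun _ => (1 : ℝ≥0∞)) (ω, s))
          (measurable_const.indicator hS).aemeasurable
    _ = _ := by
        refine lintegral_congr fun s => ?_
        have hs : MeasurableSet {ω | Y ω + t ≤ s ∧ s < X ω} :=
          measurableSet_le_and_lt (hY.add_const t) measurable_const hX
        rw [← lintegral_indicator_one hs]
        rfl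

/-- For `p ≥ 1`, the moment of order `p` of `X - Y` is a mixture of the measures of the events
`Y + t ≤ s < X` and `X + t ≤ s < Y`. -/
theorem exists_lintegral_abs_sub_rpow_eq {p : ℝ} (hp : 1 ≤ p) : ∃ m : Measure ℝ,
    ∀ (Ω : Type*) [MeasurableSpace Ω] (ρ : Measure Ω) [SFinite ρ] (X Y : Ω → ℝ),
      Measurable X → Measurable Y → ∫⁻ ω, ENNReal.ofReal (|X ω - Y ω| ^ p) ∂ρ =
      ∫⁻ t, (∫⁻ s, ρ {ω | Y ω + t ≤ s ∧ s < X ω}) + (∫⁻ s, ρ {ω | X ω + t ≤ s ∧ s < Y ω}) ∂m := by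
  obtain ⟨m, hm, hm0, hmix⟩ := exists_mixture_rpow hp
  have key : ∀ x y : ℝ, ENNReal.ofReal (|x - y| ^ p) =
      ∫⁻ t, (ENNReal.ofReal (x - y - t) + ENNReal.ofReal (y - x - t)) ∂m := by
    intro x y
    wlog hxy : y ≤ x generalizing x y
    · rw [abs_sub_comm, this y x (le_of_not_ge hxy)]
      simp_rw [add_comm]
    rw [abs_of_nonneg (sub_nonneg.2 hxy), ← hmix _ (sub_nonneg.2 hxy)]
    refine lintegral_congr_ae ?_
    filter_upwards [hm0] with t ht
    rw [ENNReal.ofReal_of_nonpos (p := y - x - t) (by linarith), add_zero]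
  refine ⟨m, ?_⟩
  intro Ω _ ρ _ X Y hX hY
  simp_rw [key]
  rw [lintegral_lintegral_swap (by fun_prop)]
  refine lintegral_congr fun t => ?_
  rw [lintegral_add_left (by fun_prop), lintegral_ofReal_sub_sub ρ hX hY,
    lintegral_ofReal_sub_sub ρ hY hX]

/-- A comparison principle for the moments of a difference: it suffices to compare, for all `t ≥ 0`
and `s`, the measures of the events `Y + t ≤ s < X` and `X + t ≤ s < Y`. -/
theorem lintegral_abs_sub_rpow_le {Ω Ω' : Type} [MeasurableSpace Ω] [MeasurableSpace Ω']
    {ρ : Measure Ω} [SFinite ρ] {ρ' : Measure Ω'} [SFinite ρ']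
    {X Y : Ω → ℝ} {X' Y' : Ω' → ℝ} (hX : Measurable X) (hY : Measurable Y)
    (hX' : Measurable X') (hY' : Measurable Y')
    (h : ∀ t s, ρ {ω | Y ω + t ≤ s ∧ s < X ω} ≤ ρ' {ω | Y' ω + t ≤ s ∧ s < X' ω})
    (h' : ∀ t s, ρ {ω | X ω + t ≤ s ∧ s < Y ω} ≤ ρ' {ω | X' ω + t ≤ s ∧ s < Y' ω})
    {p : ℝ} (hp : 1 ≤ p) :
    ∫⁻ ω, ENNReal.ofReal (|X ω - Y ω| ^ p) ∂ρ ≤ ∫⁻ ω, ENNReal.ofReal (|X' ω - Y' ω| ^ p) ∂ρ' := by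
  -- The mixing measure is chosen before the probability space, so it serves both sides.
  obtain ⟨m, hm⟩ := exists_lintegral_abs_sub_rpow_eq hp
  rw [hm _ ρ X Y hX hY, hm _ ρ' X' Y' hX' hY']
  exact lintegral_mono fun t => add_le_add (lintegral_mono fun s => h t s)
    (lintegral_mono fun s => h' t s)

/-! ### Quantile functions and optimal transport on the line -/

open ProbabilityTheory

/-- The Galois connection between a distribution function and its quantile function. -/
theorem genInverse_cdf_le_iff (α : Measure ℝ) {u : ℝ} (hu : u ∈ Ioo (0 : ℝ) 1) (x : ℝ) :
    genInverse (cdf α) u ≤ x ↔ u ≤ cdf α x := by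
  have hne : {x : ℝ | u ≤ cdf α x}.Nonempty :=
    (((tendsto_cdf_atTop α).eventually (lt_mem_nhds hu.2)).exists).imp fun _ h => h.le
  have hbdd : BddBelow {x : ℝ | u ≤ cdf α x} := by
    obtain ⟨b, hb⟩ := ((tendsto_cdf_atBot α).eventually (gt_mem_nhds hu.1)).exists
    exact ⟨b, fun x hx => le_of_lt ((monotone_cdf α).reflect_lt (hb.trans_le hx))⟩
  refine ⟨fun h => ?_, fun h => csInf_le hbdd h⟩
  refine le_trans ?_ (monotone_cdf α h)
  -- Right-continuity shows that the infimum is attained.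
  have hlim := (cdf α).right_continuous (genInverse (cdf α) u)
  refine ge_of_tendsto (hlim.tendsto.mono_left (nhdsWithin_mono _ Ioi_subset_Ici_self)) ?_
  filter_upwards [self_mem_nhdsWithin] with y hy
  obtain ⟨z, hz, hzy⟩ := exists_lt_of_csInf_lt hne hy
  exact le_trans hz (monotone_cdf α hzy.le)

/-- The quantile function, cut off outside `(0, 1)`. -/
noncomputable def openQuantile (α : Measure ℝ) : ℝ → ℝ :=
  (Ioo (0 : ℝ) 1).indicator (genInverse (cdf α))

theorem openQuantile_le_iff (α : Measure ℝ) {u : ℝ} (hu : u ∈ Ioo (0 : ℝ) 1) (x : ℝ) :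
    openQuantile α u ≤ x ↔ u ≤ cdf α x := by
  rw [openQuantile, indicator_of_mem hu, genInverse_cdf_le_iff α hu]

theorem measurable_openQuantile (α : Measure ℝ) : Measurable (openQuantile α) := by
  refine measurable_of_Iic fun x => ?_
  have : openQuantile α ⁻¹' Iic x =
      (Ioo 0 1 ∩ Iic (cdf α x)) ∪ ((Ioo 0 1)ᶜ ∩ {_u : ℝ | (0 : ℝ) ≤ x}) := by
    ext u
    by_cases hu : u ∈ Ioo (0 : ℝ) 1
    · have := openQuantile_le_iff α hu x
      simp only [mem_preimage, mem_Iic, mem_union, mem_inter_iff, hu, true_and, mem_compl_iff,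
        not_true_eq_false, false_and, or_false, this]
    · simp only [mem_preimage, mem_Iic, mem_union, mem_inter_iff, hu, false_and, mem_compl_iff,
        not_false_eq_true, true_and, false_or, openQuantile, indicator_of_notMem hu,
        mem_ofPred_eq]
  rw [this]
  exact (measurableSet_Ioo.inter measurableSet_Iic).union
    (measurableSet_Ioo.compl.inter (MeasurableSet.const _))

/-- The quantile functions of two random variables realise the optimal transport between their
distributions, for the cost `|x - y| ^ p`. -/
theorem lintegral_openQuantile_sub_le {Ω : Type} [MeasurableSpace Ω] {ρ : Measure Ω}
    [IsProbabilityMeasure ρ] {X Y : Ω → ℝ} (hX : Measurable X) (hY : Measurable Y)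
    {p : ℝ} (hp : 1 ≤ p) :
    ∫⁻ u in Icc (0 : ℝ) 1,
      ENNReal.ofReal (|openQuantile (ρ.map X) u - openQuantile (ρ.map Y) u| ^ p) ≤
    ∫⁻ ω, ENNReal.ofReal (|X ω - Y ω| ^ p) ∂ρ := by
  -- For the quantile functions the event lies in an interval of length `F_Y(s - t) - F_X(s)`,
  -- truncated at `0`. Any joint law gives at least that much, since `ρ (A \ B) ≥ ρ A - ρ B`.
  have key : ∀ {X Y : Ω → ℝ}, Measurable X → Measurable Y → ∀ t s : ℝ,
      volume.restrict (Icc (0 : ℝ) 1)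
        {u | openQuantile (ρ.map Y) u + t ≤ s ∧ s < openQuantile (ρ.map X) u} ≤
      ρ {ω | Y ω + t ≤ s ∧ s < X ω} := by
    intro X Y hX hY t s
    have := Measure.isProbabilityMeasure_map (μ := ρ) hX.aemeasurable
    have := Measure.isProbabilityMeasure_map (μ := ρ) hY.aemeasurable
    rw [← Measure.restrict_congr_set Ioo_ae_eq_Icc, Measure.restrict_apply
      (measurableSet_le_and_lt ((measurable_openQuantile _).add_const t) measurable_const
        (measurable_openQuantile _))]
    calc _ ≤ volume (Ioc (cdf (ρ.map X) s) (cdf (ρ.map Y) (s - t))) := by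
          refine measure_mono ?_
          rintro u ⟨⟨h1, h2⟩, hu⟩
          refine ⟨lt_of_not_ge fun h => ?_, (openQuantile_le_iff _ hu _).1 (by linarith)⟩
          exact absurd ((openQuantile_le_iff _ hu _).2 h) (not_le.2 h2)
      _ = ρ.map Y (Iic (s - t)) - ρ.map X (Iic s) := by
          rw [Real.volume_Ioc, ENNReal.ofReal_sub _ (cdf_nonneg _ _), ofReal_cdf, ofReal_cdf]
      _ = ρ (Y ⁻¹' Iic (s - t)) - ρ (X ⁻¹' Iic s) := by
          rw [Measure.map_apply hY measurableSet_Iic, Measure.map_apply hX measurableSet_Iic]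
      _ ≤ ρ (Y ⁻¹' Iic (s - t) \ X ⁻¹' Iic s) := le_measure_sdiff
      _ ≤ _ := by
          refine measure_mono ?_
          rintro ω ⟨h1, h2⟩
          simp only [mem_preimage, mem_Iic, not_le] at h1 h2
          exact ⟨by linarith, h2⟩
  exact lintegral_abs_sub_rpow_le (measurable_openQuantile _) (measurable_openQuantile _) hX hY
    (key hX hY) (key hY hX) hp

/-! ### Couplings on `ℝ^d` and the cost for the `p`-norm -/

theorem measurable_vecNorm {d : ℕ} {q : ℝ} (hq : 1 ≤ q) :
    Measurable fun x : Fin d → ℝ => vecNorm q x := by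
  simp_rw [vecNorm_eq_sum hq]
  fun_prop

theorem ofReal_vecNorm_rpow {d : ℕ} {p : ℝ} (hp : 1 ≤ p) (x : Fin d → ℝ) :
    ENNReal.ofReal (vecNorm p x ^ p) = ∑ i, ENNReal.ofReal (|x i| ^ p) := by
  have h : ∀ i ∈ Finset.univ, 0 ≤ |x i| ^ p := fun i _ => by positivity
  rw [vecNorm_eq_sum hp, ← Real.rpow_mul (Finset.sum_nonneg h), one_div,
    inv_mul_cancel₀ (by linarith), Real.rpow_one, ENNReal.ofReal_sum_of_nonneg h]

/-- Finite measures on `ℝ^d` with the same joint distribution function are equal. -/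
theorem ext_of_Iic_pi {d : ℕ} {μ ν : Measure (Fin d → ℝ)} [IsProbabilityMeasure μ]
    [IsProbabilityMeasure ν] (h : ∀ x, μ (Iic x) = ν (Iic x)) : μ = ν := by
  have hgen : (MeasurableSpace.pi : MeasurableSpace (Fin d → ℝ)) =
      MeasurableSpace.generateFrom (pi univ '' pi univ fun _ => range (Iic : ℝ → Set ℝ)) := by
    have hspan : IsCountablySpanning (range (Iic : ℝ → Set ℝ)) :=
      ⟨fun n : ℕ => Iic (n : ℝ), fun n => ⟨n, rfl⟩, iUnion_eq_univ_iff.2 fun x => exists_nat_ge x⟩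
    rw [← generateFrom_pi_eq fun _ => hspan]
    congr 1
    funext _
    rw [← borel_eq_generateFrom_Iic, BorelSpace.measurable_eq (α := ℝ)]
  refine ext_of_generate_finite _ hgen (IsPiSystem.pi fun _ => isPiSystem_Iic) ?_ (by simp)
  rintro _ ⟨s, hs, rfl⟩
  choose x hx using fun i => hs i (mem_univ i)
  have : pi univ s = Iic x := by
    rw [← pi_univ_Iic]
    congr 1
    exact (funext hx).symm
  rw [this, h]

/-- Applying the marginal quantile functions to a random vector distributed according to the copula
of `μ` yields a random vector with distribution `μ`. -/
theorem HasCopula.map_openQuantile {d : ℕ} {C : (Fin d → I) → I} (hC : IsCopula C)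
    {P : Measure (Fin d → I)} [IsProbabilityMeasure P]
    (hP : ∀ x, P (Iic x) = ENNReal.ofReal (C x)) {μ : Measure (Fin d → ℝ)} [IsProbabilityMeasure μ]
    (hμ : HasCopula μ C) :
    P.map (fun u i => openQuantile (μ.map fun y => y i) (u i)) = μ := by
  have hmeas : Measurable fun (u : Fin d → I) i => openQuantile (μ.map fun y => y i) (u i) :=
    measurable_pi_lambda _ fun i => (measurable_openQuantile _).comp (by fun_prop)
  have := Measure.isProbabilityMeasure_map (μ := P) hmeas.aemeasurable
  refine ext_of_Iic_pi fun x => ?_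
  -- The Galois connection holds only on the open interval; uniform margins make the endpoints
  -- negligible.
  have hae : ∀ᵐ u ∂P, ∀ i, (u i : ℝ) ∈ Ioo (0 : ℝ) 1 := by
    refine ae_all_iff.2 fun i => (hC.measurePreserving_coe_eval hP i).quasiMeasurePreserving.ae ?_
    rw [← Measure.restrict_congr_set Ioo_ae_eq_Icc]
    exact ae_restrict_mem measurableSet_Ioo
  have hjoint := hμ x
  rw [jointCdf] at hjoint
  have hIic : {y : Fin d → ℝ | ∀ i, y i ≤ x i} = Iic x := rfl
  rw [Measure.map_apply hmeas measurableSet_Iic, ← ofReal_measureReal (μ := μ), ← hIic, hjoint,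
    ← hP]
  refine measure_congr ?_
  filter_upwards [hae] with u hu
  refine propext (forall_congr' fun i => ?_)
  exact (openQuantile_le_iff _ (hu i) (x i)).trans Iff.rfl

/-- The power `p` of the `p`-norm is additive over coordinates, and the cut-off changes the quantile
functions only outside `(0, 1)`. -/
theorem quantileCost_eq_sum {d : ℕ} {p : ℝ} (hp : 1 ≤ p) (μ ν : Measure (Fin d → ℝ)) :
    quantileCost p μ ν = ∑ i, ∫⁻ u in Icc (0 : ℝ) 1, ENNReal.ofReal
      (|openQuantile (μ.map fun y => y i) u - openQuantile (ν.map fun y => y i) u| ^ p) := by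
  rw [quantileCost, ← Measure.restrict_congr_set Ioo_ae_eq_Icc, ← lintegral_finsetSum]
  · refine setLIntegral_congr_fun measurableSet_Ioo fun u hu => ?_
    simp only [ofReal_vecNorm_rpow hp, openQuantile, indicator_of_mem hu]
    rfl
  · intro i _
    have := measurable_openQuantile (μ.map fun y => y i)
    have := measurable_openQuantile (ν.map fun y => y i)
    fun_prop

/-- Every coupling costs at least as much as the quantile functions, for the `p`-norm. -/
theorem IsCoupling.quantileCost_le {d : ℕ} {p : ℝ} (hp : 1 ≤ p) {μ ν : Measure (Fin d → ℝ)}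
    [IsProbabilityMeasure μ] {π : Measure ((Fin d → ℝ) × (Fin d → ℝ))} (hπ : IsCoupling π μ ν) :
    quantileCost p μ ν ≤ ∫⁻ z, ENNReal.ofReal (vecNorm p (z.1 - z.2) ^ p) ∂π := by
  have hprob : IsProbabilityMeasure π := by
    refine ⟨?_⟩
    rw [← preimage_univ (f := Prod.fst), ← Measure.map_apply measurable_fst MeasurableSet.univ,
      hπ.1, measure_univ]
  simp_rw [ofReal_vecNorm_rpow hp]
  rw [quantileCost_eq_sum hp, lintegral_finsetSum]
  · refine Finset.sum_le_sum fun i _ => ?_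
    have h := lintegral_openQuantile_sub_le (ρ := π) (X := fun z => z.1 i) (Y := fun z => z.2 i)
      (by fun_prop) (by fun_prop) hp
    rw [← hπ.1, ← hπ.2, Measure.map_map (by fun_prop) (by fun_prop),
      Measure.map_map (by fun_prop) (by fun_prop)]
    exact h
  · intro i _
    simp only [Pi.sub_apply]
    fun_prop

/-- If `μ` and `ν` share a copula, then there is a coupling of `μ` and `ν` that costs as much as
the quantile functions, for the `p`-norm. -/
theorem ShareCopula.exists_isCoupling {d : ℕ} (hd : 1 ≤ d) {p : ℝ} (hp : 1 ≤ p)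
    {μ ν : Measure (Fin d → ℝ)} [IsProbabilityMeasure μ] [IsProbabilityMeasure ν]
    (h : ShareCopula μ ν) : ∃ π, IsCoupling π μ ν ∧
      ∫⁻ z, ENNReal.ofReal (vecNorm p (z.1 - z.2) ^ p) ∂π = quantileCost p μ ν := by
  obtain ⟨C, hC, hμ, hν⟩ := h
  obtain ⟨P, hP⟩ := hC.exists_measure hd
  set X : (Fin d → I) → Fin d → ℝ := fun u i => openQuantile (μ.map fun y => y i) (u i)
  set Y : (Fin d → I) → Fin d → ℝ := fun u i => openQuantile (ν.map fun y => y i) (u i)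
  have hX : Measurable X :=
    measurable_pi_lambda _ fun i => (measurable_openQuantile _).comp (by fun_prop)
  have hY : Measurable Y :=
    measurable_pi_lambda _ fun i => (measurable_openQuantile _).comp (by fun_prop)
  -- Both quantile maps are fed the same copula-distributed `u`, so all coordinate pairs are
  -- comonotone at once. The cost of each depends only on the uniform law of `u i`.
  refine ⟨(P : Measure (Fin d → I)).map fun u => (X u, Y u), ⟨?_, ?_⟩, ?_⟩
  · rw [Measure.map_map measurable_fst (hX.prodMk hY)]
    exact hμ.map_openQuantile hC hP
  · rw [Measure.map_map measurable_snd (hX.prodMk hY)]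
    exact hν.map_openQuantile hC hP
  · have hm : Measurable fun z : (Fin d → ℝ) × (Fin d → ℝ) =>
        ENNReal.ofReal (vecNorm p (z.1 - z.2) ^ p) :=
      (((measurable_vecNorm hp).comp (measurable_fst.sub measurable_snd)).pow_const p).ennreal_ofReal
    rw [lintegral_map hm (hX.prodMk hY), quantileCost_eq_sum hp]
    simp_rw [ofReal_vecNorm_rpow hp]
    have hQ : ∀ i, Measurable fun u : ℝ => ENNReal.ofReal
        (|openQuantile (μ.map fun y => y i) u - openQuantile (ν.map fun y => y i) u| ^ p) := by
      intro i
      have := measurable_openQuantile (μ.map fun y => y i)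
      have := measurable_openQuantile (ν.map fun y => y i)
      fun_prop
    rw [lintegral_finsetSum]
    · refine Finset.sum_congr rfl fun i _ => ?_
      exact (hC.measurePreserving_coe_eval hP i).lintegral_comp (hQ i)
    · exact fun i _ => (hQ i).comp (hC.measurePreserving_coe_eval hP i).measurable

/-- The cost of a coupling is finite if the marginals have finite moments. -/
theorem IsCoupling.lintegral_lt_top {d : ℕ} {p : ℝ} (hp : 1 ≤ p) {μ ν : Measure (Fin d → ℝ)}
    (hμ : HasFiniteMoment p μ) (hν : HasFiniteMoment p ν)
    {π : Measure ((Fin d → ℝ) × (Fin d → ℝ))} (hπ : IsCoupling π μ ν) :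
    ∫⁻ z, ENNReal.ofReal (vecNorm p (z.1 - z.2) ^ p) ∂π < ∞ := by
  have hm : Measurable fun x : Fin d → ℝ => ENNReal.ofReal (vecNorm p x ^ p) :=
    ((measurable_vecNorm hp).pow_const p).ennreal_ofReal
  have hbound : ∀ a b : ℝ, ENNReal.ofReal (|a - b| ^ p) ≤
      2 ^ (p - 1) * (ENNReal.ofReal (|a| ^ p) + ENNReal.ofReal (|b| ^ p)) := by
    intro a b
    have h0 : 0 ≤ p := by linarith
    simp_rw [← ENNReal.ofReal_rpow_of_nonneg (abs_nonneg _) h0]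
    refine le_trans (ENNReal.rpow_le_rpow ?_ h0) (ENNReal.rpow_add_le_mul_rpow_add_rpow _ _ hp)
    rw [← ENNReal.ofReal_add (abs_nonneg _) (abs_nonneg _)]
    exact ENNReal.ofReal_le_ofReal (abs_sub _ _)
  calc ∫⁻ z, ENNReal.ofReal (vecNorm p (z.1 - z.2) ^ p) ∂π
      ≤ ∫⁻ z, 2 ^ (p - 1) * (ENNReal.ofReal (vecNorm p z.1 ^ p) +
          ENNReal.ofReal (vecNorm p z.2 ^ p)) ∂π := by
        refine lintegral_mono fun z => ?_
        simp only [ofReal_vecNorm_rpow hp]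
        rw [← Finset.sum_add_distrib, Finset.mul_sum]
        exact Finset.sum_le_sum fun i _ => hbound _ _
    _ = 2 ^ (p - 1) * (∫⁻ x, ENNReal.ofReal (vecNorm p x ^ p) ∂μ +
          ∫⁻ x, ENNReal.ofReal (vecNorm p x ^ p) ∂ν) := by
        have h₁ : Measurable fun z : (Fin d → ℝ) × (Fin d → ℝ) =>
          ENNReal.ofReal (vecNorm p z.1 ^ p) := hm.comp measurable_fst
        have h₂ : Measurable fun z : (Fin d → ℝ) × (Fin d → ℝ) =>
          ENNReal.ofReal (vecNorm p z.2 ^ p) := hm.comp measurable_snd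
        rw [lintegral_const_mul _ (h₁.fun_add h₂), lintegral_add_left h₁, ← hπ.1, ← hπ.2,
          lintegral_map hm measurable_fst, lintegral_map hm measurable_snd]
    _ < ∞ := ENNReal.mul_lt_top (ENNReal.rpow_lt_top_of_nonneg (by linarith) (by simp))
        (ENNReal.add_lt_top.2 ⟨hμ, hν⟩)

/-! ### Comparing the `p`-norm and the `q`-norm -/

theorem sum_rpow_le_rpow_sum {ι : Type*} (s : Finset ι) {r : ℝ} (hr : 1 ≤ r) (f : ι → ℝ≥0∞) :
    ∑ i ∈ s, f i ^ r ≤ (∑ i ∈ s, f i) ^ r := by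
  classical
  induction s using Finset.induction_on with
  | empty => simp
  | insert a s ha ih =>
    rw [Finset.sum_insert ha, Finset.sum_insert ha]
    exact (add_le_add_right ih _).trans (ENNReal.add_rpow_le_rpow_add _ _ hr)

theorem ofReal_vecNorm_rpow_eq {d : ℕ} {p q : ℝ} (hp : 1 ≤ p) (hq : 1 ≤ q) (x : Fin d → ℝ) :
    ENNReal.ofReal (vecNorm q x ^ p) = (∑ i, ENNReal.ofReal |x i| ^ q) ^ (p / q) := by
  have hq0 : 0 < q := by linarith
  have hp0 : 0 < p := by linarith
  have h : ∀ i ∈ Finset.univ, 0 ≤ |x i| ^ q := fun i _ => by positivity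
  rw [vecNorm_eq_sum hq, ← Real.rpow_mul (Finset.sum_nonneg h), one_div_mul_eq_div,
    ← ENNReal.ofReal_rpow_of_nonneg (Finset.sum_nonneg h) (by positivity),
    ENNReal.ofReal_sum_of_nonneg h]
  congr 1
  exact Finset.sum_congr rfl fun i _ =>
    (ENNReal.ofReal_rpow_of_nonneg (abs_nonneg _) hq0.le).symm

/-- The power `p` of the `q`-norm is at least that of the `p`-norm for `q ≤ p`. -/
theorem ofReal_vecNorm_rpow_le_of_le {d : ℕ} {p q : ℝ} (hp : 1 ≤ p) (hq : 1 ≤ q) (hqp : q ≤ p)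
    (x : Fin d → ℝ) : ENNReal.ofReal (vecNorm p x ^ p) ≤ ENNReal.ofReal (vecNorm q x ^ p) := by
  have hq0 : 0 < q := by linarith
  have hp0 : 0 < p := by linarith
  rw [ofReal_vecNorm_rpow_eq hp hq, ofReal_vecNorm_rpow_eq hp hp, div_self hp0.ne',
    ENNReal.rpow_one]
  refine le_trans (le_of_eq ?_) (sum_rpow_le_rpow_sum _ ((one_le_div hq0).2 hqp) _)
  simp_rw [← ENNReal.rpow_mul, mul_div_cancel₀ p hq0.ne']

/-- The power mean inequality with exponent `p / q ≥ 1`, applied to the `d` numbers `|x i| ^ q`. -/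
theorem ofReal_vecNorm_rpow_le_mul_of_le {d : ℕ} {p q : ℝ} (hp : 1 ≤ p) (hq : 1 ≤ q) (hqp : q ≤ p)
    (x : Fin d → ℝ) : ENNReal.ofReal (vecNorm q x ^ p) ≤
      (d : ℝ≥0∞) ^ (p / q - 1) * ENNReal.ofReal (vecNorm p x ^ p) := by
  have hq0 : 0 < q := by linarith
  have hp0 : 0 < p := by linarith
  rw [ofReal_vecNorm_rpow_eq hp hq, ofReal_vecNorm_rpow_eq hp hp, div_self hp0.ne',
    ENNReal.rpow_one]
  refine (ENNReal.rpow_sum_le_const_mul_sum_rpow _ _ ((one_le_div hq0).2 hqp)).trans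
    (le_of_eq ?_)
  simp_rw [← ENNReal.rpow_mul, mul_div_cancel₀ p hq0.ne']
  simp

/-- The power `p` of the `q`-norm is at most that of the `p`-norm for `p ≤ q`. -/
theorem ofReal_vecNorm_rpow_le_of_ge {d : ℕ} {p q : ℝ} (hp : 1 ≤ p) (hq : 1 ≤ q) (hpq : p ≤ q)
    (x : Fin d → ℝ) : ENNReal.ofReal (vecNorm q x ^ p) ≤ ENNReal.ofReal (vecNorm p x ^ p) := by
  have h0 : ∀ {r}, 1 ≤ r → 0 ≤ vecNorm r x := fun hr => by
    rw [vecNorm_eq_sum hr]; positivity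
  -- With `p` and `q` exchanged, the earlier bound compares powers `q`; taking roots leads to powers
  -- `p`.
  have h := ofReal_vecNorm_rpow_le_of_le hq hp hpq x
  rw [← ENNReal.ofReal_rpow_of_nonneg (h0 hq) (by linarith),
    ← ENNReal.ofReal_rpow_of_nonneg (h0 hp) (by linarith)] at h ⊢
  exact ENNReal.rpow_le_rpow ((ENNReal.rpow_le_rpow_iff (by linarith)).1 h) (by linarith)

/-- The preceding power mean bound with `p` and `q` exchanged, raised to the power `p / q`: the
factor `d ^ (1 - p / q)` that results cancels the constant here. -/
theorem mul_ofReal_vecNorm_rpow_le_of_ge {d : ℕ} (hd : 1 ≤ d) {p q : ℝ} (hp : 1 ≤ p) (hq : 1 ≤ q)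
    (hpq : p ≤ q) (x : Fin d → ℝ) : (d : ℝ≥0∞) ^ (p / q - 1) * ENNReal.ofReal (vecNorm p x ^ p) ≤
      ENNReal.ofReal (vecNorm q x ^ p) := by
  have hq0 : 0 < q := by linarith
  have hp0 : 0 < p := by linarith
  have hd0 : (d : ℝ≥0∞) ≠ 0 := by simp; omega
  have hdt : (d : ℝ≥0∞) ≠ ∞ := ENNReal.natCast_ne_top d
  have h0 : ∀ {r}, 1 ≤ r → 0 ≤ vecNorm r x := fun hr => by
    rw [vecNorm_eq_sum hr]; positivity
  have h := ofReal_vecNorm_rpow_le_mul_of_le hq hp hpq x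
  rw [← ENNReal.ofReal_rpow_of_nonneg (h0 hq) hq0.le,
    ← ENNReal.ofReal_rpow_of_nonneg (h0 hp) hq0.le] at h
  rw [← ENNReal.ofReal_rpow_of_nonneg (h0 hq) hp0.le,
    ← ENNReal.ofReal_rpow_of_nonneg (h0 hp) hp0.le]
  have h1 := ENNReal.rpow_le_rpow h (z := p / q) (by positivity)
  rw [ENNReal.mul_rpow_of_nonneg _ _ (by positivity), ← ENNReal.rpow_mul, ← ENNReal.rpow_mul,
    ← ENNReal.rpow_mul, mul_div_cancel₀ p hq0.ne'] at h1
  calc _ ≤ (d : ℝ≥0∞) ^ (p / q - 1) * ((d : ℝ≥0∞) ^ ((q / p - 1) * (p / q)) *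
        ENNReal.ofReal (vecNorm q x) ^ p) := by gcongr
    _ = _ := by
      rw [← mul_assoc, ← ENNReal.rpow_add _ _ hd0 hdt]
      have : p / q - 1 + (q / p - 1) * (p / q) = 0 := by field_simp; ring
      rw [this, ENNReal.rpow_zero, one_mul]

/-! ### From norm bounds to the Wasserstein distance -/

theorem wasserstein_rpow {d : ℕ} {p : ℝ} (hp : 1 ≤ p) (q : ℝ) (μ ν : Measure (Fin d → ℝ)) :
    wasserstein p q μ ν ^ p = ⨅ (π : Measure ((Fin d → ℝ) × (Fin d → ℝ))) (_ : IsCoupling π μ ν),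
      ∫⁻ z, ENNReal.ofReal (vecNorm q (z.1 - z.2) ^ p) ∂π := by
  rw [wasserstein, ← ENNReal.rpow_mul, one_div_mul_cancel (by linarith), ENNReal.rpow_one]

/-- A bound of the `p`-norm by the `q`-norm bounds the quantile cost by the Wasserstein distance. -/
theorem mul_quantileCost_le_wasserstein_rpow {d : ℕ} {p q : ℝ} (hp : 1 ≤ p) {c : ℝ≥0∞}
    (hc : ∀ x : Fin d → ℝ, c * ENNReal.ofReal (vecNorm p x ^ p) ≤ ENNReal.ofReal (vecNorm q x ^ p))
    (μ ν : Measure (Fin d → ℝ)) [IsProbabilityMeasure μ] :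
    c * quantileCost p μ ν ≤ wasserstein p q μ ν ^ p := by
  rw [wasserstein_rpow hp]
  refine le_iInf₂ fun π hπ => (mul_le_mul_right (hπ.quantileCost_le hp) c).trans ?_
  exact (lintegral_const_mul_le _ _).trans (lintegral_mono fun z => hc _)

/-- If `μ` and `ν` share a copula, a bound of the `q`-norm by the `p`-norm bounds the Wasserstein
distance by the quantile cost. -/
theorem ShareCopula.wasserstein_rpow_le {d : ℕ} (hd : 1 ≤ d) {p q : ℝ} (hp : 1 ≤ p) {c : ℝ≥0∞}
    (hc : ∀ x : Fin d → ℝ, ENNReal.ofReal (vecNorm q x ^ p) ≤ c * ENNReal.ofReal (vecNorm p x ^ p))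
    {μ ν : Measure (Fin d → ℝ)} [IsProbabilityMeasure μ] [IsProbabilityMeasure ν]
    (h : ShareCopula μ ν) : wasserstein p q μ ν ^ p ≤ c * quantileCost p μ ν := by
  obtain ⟨π, hπ, hcost⟩ := h.exists_isCoupling hd hp
  have hm : Measurable fun z : (Fin d → ℝ) × (Fin d → ℝ) =>
      ENNReal.ofReal (vecNorm p (z.1 - z.2) ^ p) :=
    (((measurable_vecNorm hp).comp (measurable_fst.sub measurable_snd)).pow_const p).ennreal_ofReal
  rw [wasserstein_rpow hp, ← hcost, ← lintegral_const_mul _ hm]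
  exact (iInf₂_le π hπ).trans (lintegral_mono fun z => hc _)

end CopulaWasserstein

theorem corollary3p7 {d : ℕ} (hd : 1 ≤ d) (p q : ℝ) (hp : 1 ≤ p) (hq : 1 ≤ q) (hqp : q ≠ p)
    (μ ν : MeasureTheory.Measure (Fin d → ℝ))
    [MeasureTheory.IsProbabilityMeasure μ] [MeasureTheory.IsProbabilityMeasure ν]
    (hμ : CopulaWasserstein.HasFiniteMoment p μ) (hν : CopulaWasserstein.HasFiniteMoment p ν)
    (hC : CopulaWasserstein.ShareCopula μ ν) :
    CopulaWasserstein.quantileCost p μ ν < ∞ ∧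
    CopulaWasserstein.wasserstein p q μ ν < ∞ ∧
    (q ≤ p →
      CopulaWasserstein.quantileCost p μ ν ≤ CopulaWasserstein.wasserstein p q μ ν ^ p ∧
      CopulaWasserstein.wasserstein p q μ ν ^ p ≤
        (d : ℝ≥0∞) ^ (p / q - 1) * CopulaWasserstein.quantileCost p μ ν) ∧
    (p ≤ q →
      (d : ℝ≥0∞) ^ (p / q - 1) * CopulaWasserstein.quantileCost p μ ν ≤
        CopulaWasserstein.wasserstein p q μ ν ^ p ∧
      CopulaWasserstein.wasserstein p q μ ν ^ p ≤ CopulaWasserstein.quantileCost p μ ν) := by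
  open CopulaWasserstein in
  have hp0 : 0 < p := by linarith
  have hfin : quantileCost p μ ν < ∞ := by
    obtain ⟨π, hπ, hcost⟩ := hC.exists_isCoupling hd hp
    rw [← hcost]
    exact hπ.lintegral_lt_top hp hμ hν
  have hupper₁ (h : q ≤ p) : wasserstein p q μ ν ^ p ≤
      (d : ℝ≥0∞) ^ (p / q - 1) * quantileCost p μ ν :=
    hC.wasserstein_rpow_le hd hp (ofReal_vecNorm_rpow_le_mul_of_le hp hq h)
  have hupper₂ (h : p ≤ q) : wasserstein p q μ ν ^ p ≤ quantileCost p μ ν := by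
    simpa using hC.wasserstein_rpow_le hd hp (c := 1) (q := q)
      fun x => by simpa using ofReal_vecNorm_rpow_le_of_ge hp hq h x
  refine ⟨hfin, ?_, fun h => ⟨?_, hupper₁ h⟩, fun h => ⟨?_, hupper₂ h⟩⟩
  -- Finiteness of the distance follows from the upper bounds, whose constants are finite.
  · rw [← ENNReal.rpow_lt_top_iff_of_pos hp0]
    rcases le_total q p with h | h
    · refine (hupper₁ h).trans_lt (ENNReal.mul_lt_top ?_ hfin)
      exact ENNReal.rpow_lt_top_of_nonneg
        (sub_nonneg.2 ((one_le_div (by linarith)).2 h)) (ENNReal.natCast_ne_top d)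
    · exact (hupper₂ h).trans_lt hfin
  · simpa using mul_quantileCost_le_wasserstein_rpow hp (c := 1) (q := q)
      (fun x => by simpa using ofReal_vecNorm_rpow_le_of_le hp hq h x) μ ν
  · exact mul_quantileCost_le_wasserstein_rpow hp (mul_ofReal_vecNorm_rpow_le_of_ge hd hp hq h) μ ν
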